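/- Let $n \ge 0$ and $R_n = \mathbb{Q}[x_1,\dots,x_n]$. A polynomial $f \in R_n$ is quasisymmetric if for all $k \ge 0$, all positive integers $a_1,\dots,a_k$ and all indices $1 \le i_1 < \cdots < i_k \le n$ and $1 \le j_1 < \cdots < j_k \le n$, the coefficients of $x_{i_1}^{a_1}\cdots x_{i_k}^{a_k}$ and $x_{j_1}^{a_1}\cdots x_{j_k}^{a_k}$ in $f$ are equal. Let $\langle \mathrm{QSym}_n^+\rangle \subseteq R_n$ be the ideal generated by the quasisymmetric polynomials with zero constant term. A noncrossing partition $\lambda$ of size $n$ is a set of arcs $(i,j)$, $1 \le i < j \le n$, such that no two distinct arcs $(i,k),(j,l)\in\lambda$ satisfy $i \le j < k \le l$; it is also regarded as an undirected graph on $\{1,\dots,n\}$. Its permutation $Q_\lambda \in S_n$ is defined by $Q_\lambda(j) = i$ if $(i,j) \in \lambda$ for some (necessarily unique) $i$, and otherwise $Q_\lambda(j)$ is the largest element of the connected component of $j$ in $\lambda$. Let $\mathrm{QSV}_n = \{Q_\lambda\} \subseteq S_n$, where $\lambda$ runs over all noncrossing partitions of size $n$; identify $\sigma \in S_n$ with the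 point $(\sigma(1),\dots,\sigma(n)) \in \mathbb{Q}^n$, and let $\mathbf{I}(\mathrm{QSV}_n) \subseteq R_n$ be the ideal of all polynomials that vanish at every point of $\mathrm{QSV}_n$. Then $$R_n/\langle \mathrm{QSym}_n^+\rangle \;\cong\; R_n/\mathbf{I}(\mathrm{QSV}_n)$$ as $\mathbb{Q}$-vector spaces, and both quotients have dimension over $\mathbb{Q}$ equal to the Catalan number $C_n = \frac{1}{n+1}\binom{2n}{n}$. -/

import Mathlib

namespace QuasisymmetricVariety

/-- A noncrossing partition of size `n`: a set of arcs `(i, j)` with `i < j` on the vertices of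
`Fin n` (vertex `i : Fin n` stands for the integer `i + 1`), such that no two distinct arcs
`(i, k)`, `(j, l)` satisfy `i ≤ j < k ≤ l` (no intersections, no common left endpoint and no
common right endpoint). -/
structure NCP (n : ℕ) where
  arcs : Finset (Fin n × Fin n)
  lt_of_mem : ∀ {i j : Fin n}, (i, j) ∈ arcs → i < j
  noncrossing : ∀ {i j k l : Fin n}, (i, k) ∈ arcs → (j, l) ∈ arcs → (i, k) ≠ (j, l) →
    ¬ (i ≤ j ∧ j < k ∧ k ≤ l)

namespace NCP

variable {n : ℕ} (lam : NCP n)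

/-- The noncrossing partition considered as an undirected graph. -/
def graph : SimpleGraph (Fin n) := SimpleGraph.fromRel fun i j => (i, j) ∈ lam.arcs

open Classical in
/-- The connected component of `j`, as a finite set. -/
noncomputable def component (j : Fin n) : Finset (Fin n) :=
  Finset.univ.filter fun k => lam.graph.Reachable j k

theorem self_mem_component (j : Fin n) : j ∈ lam.component j := by
  simp [component]

open Classical in
/-- `j` is sent to its leftward neighbour if `j` is a right endpoint, and to the largest element
of its connected component otherwise. -/
noncomputable def qFun (j : Fin n) : Fin n :=
  if h : ∃ i, (i, j) ∈ lam.arcs then h.choose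
  else (lam.component j).max' ⟨j, lam.self_mem_component j⟩

variable {lam}

theorem left_unique {i i' j : Fin n} (h : (i, j) ∈ lam.arcs) (h' : (i', j) ∈ lam.arcs) :
    i = i' := by
  by_contra hne
  rcases lt_or_gt_of_ne hne with hl | hl
  · exact lam.noncrossing h h' (by simp [hne]) ⟨hl.le, lam.lt_of_mem h', le_rfl⟩
  · exact lam.noncrossing h' h (by simp [Ne.symm hne]) ⟨hl.le, lam.lt_of_mem h, le_rfl⟩

theorem right_unique {i j j' : Fin n} (h : (i, j) ∈ lam.arcs) (h' : (i, j') ∈ lam.arcs) :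
    j = j' := by
  by_contra hne
  rcases lt_or_gt_of_ne hne with hl | hl
  · exact lam.noncrossing h h' (by simp [hne]) ⟨le_rfl, lam.lt_of_mem h, hl.le⟩
  · exact lam.noncrossing h' h (by simp [Ne.symm hne]) ⟨le_rfl, lam.lt_of_mem h', hl.le⟩

theorem qFun_of_mem {i j : Fin n} (h : (i, j) ∈ lam.arcs) : lam.qFun j = i := by
  have hex : ∃ i, (i, j) ∈ lam.arcs := ⟨i, h⟩
  rw [qFun, dif_pos hex]
  exact left_unique hex.choose_spec h

theorem qFun_of_not {j : Fin n} (h : ¬ ∃ i, (i, j) ∈ lam.arcs) :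
    lam.qFun j = (lam.component j).max' ⟨j, lam.self_mem_component j⟩ := by
  rw [qFun, dif_neg h]

theorem adj_of_mem {i j : Fin n} (h : (i, j) ∈ lam.arcs) : lam.graph.Adj i j := by
  rw [graph, SimpleGraph.fromRel_adj]
  exact ⟨(lam.lt_of_mem h).ne, Or.inl h⟩

theorem chain_of_reachable {x y : Fin n} (h : lam.graph.Reachable x y) :
    Relation.ReflTransGen (fun i j => (i, j) ∈ lam.arcs) x y ∨
      Relation.ReflTransGen (fun i j => (i, j) ∈ lam.arcs) y x := by
  rw [SimpleGraph.reachable_iff_reflTransGen] at h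
  induction h with
  | refl => exact Or.inl .refl
  | @tail b c _ hbc ih =>
    rw [graph, SimpleGraph.fromRel_adj] at hbc
    rcases hbc.2 with hr | hr <;> rcases ih with ih | ih
    · exact Or.inl (ih.tail hr)
    · rcases ih.cases_head with rfl | ⟨d, hd, hdx⟩
      · exact Or.inl (.single hr)
      · obtain rfl := right_unique hr hd
        exact Or.inr hdx
    · rcases ih.cases_tail with rfl | ⟨d, hxd, hd⟩
      · exact Or.inr (.single hr)
      · obtain rfl := left_unique hr hd
        exact Or.inl hxd
    · exact Or.inr (ih.head hr)

theorem eq_of_reachable {x y : Fin n} (h : lam.graph.Reachable x y)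
    (hx : ¬ ∃ i, (i, x) ∈ lam.arcs) (hy : ¬ ∃ i, (i, y) ∈ lam.arcs) : x = y := by
  rcases chain_of_reachable h with h | h
  · rcases h.cases_tail with h | ⟨d, _, hd⟩
    · exact h.symm
    · exact absurd ⟨d, hd⟩ hy
  · rcases h.cases_tail with h | ⟨d, _, hd⟩
    · exact h
    · exact absurd ⟨d, hd⟩ hx

theorem reachable_max (j : Fin n) : lam.graph.Reachable j
    ((lam.component j).max' ⟨j, lam.self_mem_component j⟩) := by
  have := (lam.component j).max'_mem ⟨j, lam.self_mem_component j⟩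
  simpa [component] using this

theorem qFun_ne {i j j' : Fin n} (h : (i, j) ∈ lam.arcs) (h' : ¬ ∃ i, (i, j') ∈ lam.arcs) :
    lam.qFun j' ≠ i := by
  intro he
  rw [qFun_of_not h'] at he
  have hr : lam.graph.Reachable j' i := he ▸ reachable_max j'
  have hj : j ∈ lam.component j' := by
    simpa [component] using hr.trans (adj_of_mem h).reachable
  have := (lam.component j').le_max' j hj
  rw [he] at this
  exact absurd (lam.lt_of_mem h) (not_lt.mpr this)

theorem qFun_injective : Function.Injective lam.qFun := by
  intro a b hab
  by_cases ha : ∃ i, (i, a) ∈ lam.arcs <;> by_cases hb : ∃ i, (i, b) ∈ lam.arcs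
  · obtain ⟨i, hi⟩ := ha
    obtain ⟨i', hi'⟩ := hb
    rw [qFun_of_mem hi, qFun_of_mem hi'] at hab
    subst hab
    exact right_unique hi hi'
  · obtain ⟨i, hi⟩ := ha
    rw [qFun_of_mem hi] at hab
    exact absurd hab.symm (qFun_ne hi hb)
  · obtain ⟨i, hi⟩ := hb
    rw [qFun_of_mem hi] at hab
    exact absurd hab (qFun_ne hi ha)
  · rw [qFun_of_not ha, qFun_of_not hb] at hab
    have h1 := reachable_max (lam := lam) a
    rw [hab] at h1
    exact eq_of_reachable (h1.trans (reachable_max b).symm) ha hb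

variable (lam)

/-- The permutation `Q_λ` of the noncrossing partition `λ`. -/
noncomputable def Q : Equiv.Perm (Fin n) :=
  Equiv.ofBijective lam.qFun (Finite.injective_iff_bijective.mp qFun_injective)

end NCP

/-- The set `QSV_n` of permutations. -/
def QSV (n : ℕ) : Set (Equiv.Perm (Fin n)) := Set.range NCP.Q

/-- The point `(σ_1, …, σ_n)` of `ℚⁿ`; the values are shifted by one since `Fin n` starts
at `0`. -/
def point {n : ℕ} (σ : Equiv.Perm (Fin n)) : Fin n → ℚ := fun j => ((σ j : ℕ) : ℚ) + 1

/-- The vanishing ideal in `ℚ[x_1, …, x_n]` of the points of `QSV_n`. -/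
noncomputable def idealQSV (n : ℕ) : Ideal (MvPolynomial (Fin n) ℚ) :=
  MvPolynomial.vanishingIdeal ℚ (point '' QSV n)

/-- A polynomial is quasisymmetric if for all positive exponents `a_1, …, a_k` and all
`i_1 < ⋯ < i_k` and `i'_1 < ⋯ < i'_k`, the monomials `x_{i_1}^{a_1} ⋯ x_{i_k}^{a_k}` and
`x_{i'_1}^{a_1} ⋯ x_{i'_k}^{a_k}` have the same coefficient. -/
def IsQuasisymmetric {n : ℕ} (f : MvPolynomial (Fin n) ℚ) : Prop :=
  ∀ (k : ℕ) (a : Fin k → ℕ), (∀ s, 0 < a s) → ∀ i i' : Fin k ↪o Fin n,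
    f.coeff (∑ s, Finsupp.single (i s) (a s)) = f.coeff (∑ s, Finsupp.single (i' s) (a s))

/-- The ideal generated by the quasisymmetric polynomials without constant term. -/
noncomputable def idealQSymPlus (n : ℕ) : Ideal (MvPolynomial (Fin n) ℚ) :=
  Ideal.span {f | IsQuasisymmetric f ∧ MvPolynomial.constantCoeff f = 0}

end QuasisymmetricVariety

/-!
Call an exponent vector subdiagonal if for each `k ≥ 1` its last `k` entries sum to less than `k`.
The subdiagonal monomials form a basis of the quotient by `idealQSymPlus n`, and splitting off the
last entry shows that their number is a ballot number, namely the Catalan number.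

They span because a monomial which is not subdiagonal can be rewritten in lexicographically smaller
ones. Processing the variables from the last one down, its exponents are collected into a list
`β`, and the recursion for the fundamental quasisymmetric polynomial `F_β`, which lies in the
ideal, exhibits the monomial as the leading term. A zero exponent is skipped at the price of
lowering the first entry of `β` by one. The failure of subdiagonality keeps `β` from running empty
before the variables are exhausted.

They are independent by induction on `n`. Let `R_i` set `x_i = 0` and renumber the remaining
variables. As `R_{i+1} f = R_i f` for quasisymmetric `f`, the operators
`f ↦ (R_{i+1} f - R_i f) / x_i` map the ideal for `n + 1` variables to the ideal for `n`
variables, and they preserve subdiagonality. Hence they kill a subdiagonal `f` in the ideal, so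
`R_0 f = ⋯ = R_n f`. A monomial of `f` can then be shifted until it contains the last variable,
which a subdiagonal monomial never does.

On the other side, `Q_λ` determines the arcs of `λ` as the pairs `(Q_λ(j), j)` with `Q_λ(j) < j`,
so `QSV n` has as many points as there are noncrossing partitions. These grow by adding a last
vertex, which is either isolated or joined to a vertex under no arc, and counting them with the
number of such vertices recorded gives the same ballot numbers.
-/

namespace QuasisymmetricVariety

/-! ### Ballot numbers -/

/-- The ballot numbers: `ballot n s` is the number of sequences `h 0, h 1, …, h n` of natural
numbers with `h 0 = s` and `1 ≤ h (k + 1) ≤ h k + 1` for all `k < n`. -/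
def ballot : ℕ → ℕ → ℕ
  | 0, _ => 1
  | n + 1, s => ∑ j ∈ Finset.range (s + 1), ballot n (j + 1)

theorem ballot_succ_succ (n s : ℕ) :
    ballot (n + 1) (s + 1) = ballot (n + 1) s + ballot n (s + 2) := by
  simp only [ballot, Finset.sum_range_succ]

theorem ballot_succ_zero (n : ℕ) : ballot (n + 1) 0 = ballot n 1 := by
  simp [ballot]

theorem ballot_succ_add_choose (n s : ℕ) :
    ballot (n + 1) s + (2 * n + s + 2).choose n = (2 * n + s + 2).choose (n + 1) := by
  induction n generalizing s with
  | zero => simp [ballot]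
  | succ n ih =>
    induction s with
    | zero =>
      have symm : (2 * n + 3).choose (n + 1) = (2 * n + 3).choose (n + 2) :=
        Nat.choose_symm_of_eq_add (by ring)
      have pascal := Nat.choose_succ_succ' (2 * n + 3) n
      have pascal' := Nat.choose_succ_succ' (2 * n + 3) (n + 1)
      have ih₁ := ih 1
      rw [ballot_succ_zero]
      simp only [mul_add, add_assoc, Nat.reduceAdd, mul_one, add_zero] at *
      omega
    | succ s ihs =>
      have pascal := Nat.choose_succ_succ' (2 * (n + 1) + s + 2) n
      have pascal' := Nat.choose_succ_succ' (2 * (n + 1) + s + 2) (n + 1)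
      have ih₂ := ih (s + 2)
      rw [show 2 * n + (s + 2) + 2 = 2 * (n + 1) + s + 2 by ring] at ih₂
      rw [show 2 * (n + 1) + (s + 1) + 2 = 2 * (n + 1) + s + 2 + 1 by ring, ballot_succ_succ]
      omega

theorem ballot_zero_right (n : ℕ) : ballot n 0 = catalan n := by
  cases n with
  | zero => rw [catalan_zero, ballot]
  | succ n =>
    have hballot := ballot_succ_add_choose n 0
    have hcatalan := succ_mul_catalan_eq_centralBinom (n + 1)
    have hchoose := Nat.choose_succ_right_eq (2 * n + 2) n
    rw [Nat.centralBinom_eq_two_mul_choose, show 2 * (n + 1) = 2 * n + 2 by ring] at hcatalan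
    rw [show 2 * n + 2 - n = n + 2 by omega] at hchoose
    rw [add_zero] at hballot
    refine Nat.eq_of_mul_eq_mul_left n.succ.succ_pos ?_
    rw [hcatalan]
    nlinarith

/-! ### Subdiagonal sequences -/

/-- The sum of the entries of `w` from position `i` on. -/
def tailSum {n : ℕ} (w : Fin n → ℕ) (i : Fin n) : ℕ := ∑ l with i ≤ l, w l

/-- A sequence `w` of length `n` is subdiagonal with slack `s` if for each `k ≥ 1` its last `k`
entries sum to less than `k + s`. For `s = 0` these are the exponents of the monomials that
represent a basis of the quotient by `idealQSymPlus n`. -/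
def SubDiag (n s : ℕ) (w : Fin n → ℕ) : Prop :=
  ∀ i : Fin n, tailSum w i + i < n + s

section SubDiag

variable {n s : ℕ}

theorem tailSum_snoc_castSucc (w : Fin n → ℕ) (c : ℕ) (i : Fin n) :
    tailSum (Fin.snoc w c : Fin (n + 1) → ℕ) i.castSucc = tailSum w i + c := by
  simp [tailSum, Finset.sum_filter, Fin.sum_univ_castSucc, Fin.le_last]

theorem tailSum_last (w : Fin (n + 1) → ℕ) : tailSum w (Fin.last n) = w (Fin.last n) := by
  simp [tailSum, Fin.last_le_iff, Finset.sum_filter]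

theorem subDiag_snoc (w : Fin n → ℕ) (c : ℕ) :
    SubDiag (n + 1) s (Fin.snoc w c : Fin (n + 1) → ℕ) ↔ c ≤ s ∧ SubDiag n (s + 1 - c) w := by
  simp only [SubDiag, Fin.forall_fin_succ', tailSum_snoc_castSucc, tailSum_last, Fin.snoc_last,
    Fin.val_last, Fin.val_castSucc]
  rw [and_comm, show c + n < n + 1 + s ↔ c ≤ s by omega]
  exact and_congr_right fun hc => forall_congr' fun i => by omega

/-- Splitting off the last entry of a subdiagonal sequence. -/
def subDiagSuccEquiv (n s : ℕ) :
    {w // SubDiag (n + 1) s w} ≃ Σ c : Fin (s + 1), {w // SubDiag n (s + 1 - c) w} where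
  toFun w :=
    have h : w.1 (Fin.last n) ≤ s ∧ SubDiag n (s + 1 - w.1 (Fin.last n)) (Fin.init w.1) := by
      rw [← subDiag_snoc, Fin.snoc_init_self]; exact w.2
    ⟨⟨w.1 (Fin.last n), by omega⟩, Fin.init w.1, h.2⟩
  invFun p := ⟨Fin.snoc p.2.1 p.1, (subDiag_snoc _ _).2 ⟨by omega, p.2.2⟩⟩
  left_inv w := by simp
  right_inv p := by
    obtain ⟨⟨c, hc⟩, w, hw⟩ := p
    simp only [Sigma.mk.injEq, Fin.snoc_last, true_and]
    congr! 2 <;> simp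

instance finite_subDiag (n s : ℕ) : Finite {w // SubDiag n s w} := by
  induction n generalizing s with
  | zero => infer_instance
  | succ n ih => exact Finite.of_equiv _ (subDiagSuccEquiv n s).symm

theorem card_subDiag (n s : ℕ) : Nat.card {w // SubDiag n s w} = ballot n s := by
  induction n generalizing s with
  | zero => exact Nat.card_eq_one_iff_unique.2 ⟨inferInstance, ⟨Fin.elim0, fun i => i.elim0⟩⟩
  | succ n ih =>
    rw [Nat.card_congr (subDiagSuccEquiv n s), Nat.card_sigma, ballot,
      Fin.sum_univ_eq_sum_range (fun c => Nat.card {w // SubDiag n (s + 1 - c) w}),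
      ← Finset.sum_range_reflect]
    refine Finset.sum_congr rfl fun j hj => ?_
    rw [Finset.mem_range] at hj
    rw [show s + 1 - (s + 1 - 1 - j) = j + 1 by omega, ih]

end SubDiag

/-! ### Counting noncrossing partitions -/

/-- A set of arcs on `ℕ` that is noncrossing in the sense of `NCP`. -/
def IsNC (A : Finset (ℕ × ℕ)) : Prop :=
  (∀ p ∈ A, p.1 < p.2) ∧
    ∀ p ∈ A, ∀ q ∈ A, p ≠ q → ¬ (p.1 ≤ q.1 ∧ q.1 < p.2 ∧ p.2 ≤ q.2)

open Classical in
/-- The noncrossing sets of arcs on the vertices `0, …, n - 1`; a copy of `NCP n` whose elements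
live in a type that does not depend on `n`. -/
noncomputable def ncSets (n : ℕ) : Finset (Finset (ℕ × ℕ)) :=
  {A ∈ (Finset.range n ×ˢ Finset.range n).powerset | IsNC A}

/-- The vertices `i < n` that lie under no arc of `A`, that is, `a ≤ i < b` for no `(a, b) ∈ A`.
These are the vertices that can be joined to a new vertex `n`. -/
def uncovered (n : ℕ) (A : Finset (ℕ × ℕ)) : Finset ℕ :=
  {i ∈ Finset.range n | ∀ p ∈ A, p.1 ≤ i → p.2 ≤ i}

section NoncrossingSets

variable {n i : ℕ} {A : Finset (ℕ × ℕ)}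

theorem mem_ncSets : A ∈ ncSets n ↔ (∀ p ∈ A, p.2 < n) ∧ IsNC A := by
  classical
  rw [ncSets, Finset.mem_filter, Finset.mem_powerset]
  refine and_congr_left fun hA => ⟨fun h p hp => ?_, fun h p hp => ?_⟩
  · exact Finset.mem_range.1 (Finset.mem_product.1 (h hp)).2
  · exact Finset.mem_product.2
      ⟨Finset.mem_range.2 ((hA.1 p hp).trans (h p hp)), Finset.mem_range.2 (h p hp)⟩

theorem mem_uncovered : i ∈ uncovered n A ↔ i < n ∧ ∀ p ∈ A, p.1 ≤ i → p.2 ≤ i := by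
  rw [uncovered, Finset.mem_filter, Finset.mem_range]

theorem ncSets_zero : ncSets 0 = {∅} := by
  ext A
  rw [mem_ncSets, Finset.mem_singleton, Finset.eq_empty_iff_forall_notMem]
  refine ⟨fun h p hp => absurd (h.1 p hp) (Nat.not_lt_zero _), fun h => ⟨?_, ?_, ?_⟩⟩ <;>
    exact fun p hp => absurd hp (h p)

theorem insert_mem_ncSets (hA : A ∈ ncSets n) (hi : i ∈ uncovered n A) :
    insert (i, n) A ∈ ncSets (n + 1) := by
  rw [mem_ncSets] at hA ⊢
  obtain ⟨hlt, hle⟩ := mem_uncovered.1 hi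
  obtain ⟨hn, hord, hnc⟩ := hA
  refine ⟨?_, ?_, ?_⟩
  · exact (Finset.forall_mem_insert _ _ _).2
      ⟨n.lt_succ_self, fun p hp => (hn p hp).trans n.lt_succ_self⟩
  · exact (Finset.forall_mem_insert _ _ _).2 ⟨hlt, hord⟩
  · simp only [Finset.forall_mem_insert]
    refine ⟨⟨by simp, fun q hq _ => ?_⟩, fun p hp => ⟨fun _ => ?_, hnc p hp⟩⟩
    · have := hn q hq
      omega
    · have := hle p hp
      omega

theorem exists_insert_eq_of_mem_ncSets_succ (hA : A ∈ ncSets (n + 1)) (hA' : A ∉ ncSets n) :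
    ∃ B ∈ ncSets n, ∃ i ∈ uncovered n B, insert (i, n) B = A := by
  rw [mem_ncSets] at hA hA'
  obtain ⟨hn, hord, hnc⟩ := hA
  obtain ⟨⟨i, j⟩, hp, hj⟩ : ∃ p ∈ A, n ≤ p.2 := by
    by_contra! h
    exact hA' ⟨h, hord, hnc⟩
  obtain rfl : j = n := le_antisymm (Nat.lt_succ_iff.1 (hn _ hp)) hj
  have hin : i < j := hord _ hp
  refine ⟨A.erase (i, j), mem_ncSets.2 ⟨fun q hq => ?_, ?_, ?_⟩, i, mem_uncovered.2 ⟨hin, ?_⟩,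
    Finset.insert_erase hp⟩
  · have hq' := Finset.mem_of_mem_erase hq
    have hne := Finset.ne_of_mem_erase hq
    have hqord := hord q hq'
    have hqle := hnc q hq' _ hp hne
    have hqge := hnc _ hp q hq' hne.symm
    have := hn q hq'
    omega
  · exact fun q hq => hord q (Finset.mem_of_mem_erase hq)
  · exact fun q hq r hr => hnc q (Finset.mem_of_mem_erase hq) r (Finset.mem_of_mem_erase hr)
  · intro q hq hqi
    have := hnc q (Finset.mem_of_mem_erase hq) _ hp (Finset.ne_of_mem_erase hq)
    have := hn q (Finset.mem_of_mem_erase hq)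
    omega

theorem filter_insert_snd_lt (hA : A ∈ ncSets n) (i : ℕ) :
    {p ∈ insert (i, n) A | p.2 < n} = A := by
  rw [Finset.filter_insert, if_neg (lt_irrefl n)]
  exact Finset.filter_true_of_mem (mem_ncSets.1 hA).1

theorem insert_injOn : Set.InjOn (fun x : Σ _ : Finset (ℕ × ℕ), ℕ => insert (x.2, n) x.1)
    ((ncSets n).sigma (uncovered n)) := by
  rintro ⟨A, i⟩ hA ⟨B, j⟩ hB h
  simp only [Finset.coe_sigma, Set.mem_sigma_iff, Finset.mem_coe] at hA hB h
  obtain rfl : A = B := by rw [← filter_insert_snd_lt hA.1 i, h, filter_insert_snd_lt hB.1 j]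
  have hi : (i, n) ∈ insert (j, n) A := h ▸ Finset.mem_insert_self _ _
  rcases Finset.mem_insert.1 hi with h | h
  · simpa using h
  · exact absurd ((mem_ncSets.1 hA.1).1 _ h) (lt_irrefl n)

theorem ncSets_succ (n : ℕ) : ncSets (n + 1) = ncSets n ∪
    ((ncSets n).sigma (uncovered n)).image fun x => insert (x.2, n) x.1 := by
  ext A
  simp only [Finset.mem_union, Finset.mem_image, Finset.mem_sigma, Sigma.exists]
  constructor
  · intro hA
    by_cases hA' : A ∈ ncSets n
    · exact Or.inl hA'
    · obtain ⟨B, hB, i, hi, rfl⟩ := exists_insert_eq_of_mem_ncSets_succ hA hA'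
      exact Or.inr ⟨B, i, ⟨hB, hi⟩, rfl⟩
  · rintro (hA | ⟨B, i, ⟨hB, hi⟩, rfl⟩)
    · rw [mem_ncSets] at hA ⊢
      exact ⟨fun p hp => (hA.1 p hp).trans n.lt_succ_self, hA.2⟩
    · exact insert_mem_ncSets hB hi

theorem sum_ncSets_succ {M : Type*} [AddCommMonoid M] (f : Finset (ℕ × ℕ) → M) (n : ℕ) :
    ∑ A ∈ ncSets (n + 1), f A =
      ∑ A ∈ ncSets n, (∑ i ∈ uncovered n A, f (insert (i, n) A) + f A) := by
  rw [ncSets_succ, Finset.sum_union, Finset.sum_image insert_injOn, Finset.sum_sigma,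
    Finset.sum_add_distrib, add_comm]
  rw [Finset.disjoint_left]
  rintro _ hA h
  obtain ⟨x, -, rfl⟩ := Finset.mem_image.1 h
  exact absurd ((mem_ncSets.1 hA).1 _ (Finset.mem_insert_self _ _)) (lt_irrefl n)

theorem card_uncovered_succ (hA : A ∈ ncSets n) :
    (uncovered (n + 1) A).card = (uncovered n A).card + 1 := by
  rw [← Finset.card_insert_of_notMem (a := n) (by simp [mem_uncovered])]
  congr 1
  ext k
  have hk : ∀ p ∈ A, n ≤ k → p.2 ≤ k := fun p hp h => ((mem_ncSets.1 hA).1 p hp).le.trans h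
  rw [Finset.mem_insert, mem_uncovered, mem_uncovered]
  grind

theorem card_uncovered_succ_insert (hA : A ∈ ncSets n) (hi : i ∈ uncovered n A) :
    (uncovered (n + 1) (insert (i, n) A)).card = {k ∈ uncovered n A | k < i}.card + 1 := by
  rw [← Finset.card_insert_of_notMem (a := n) (by simp [mem_uncovered])]
  congr 1
  ext k
  have hk : ∀ p ∈ A, n ≤ k → p.2 ≤ k := fun p hp h => ((mem_ncSets.1 hA).1 p hp).le.trans h
  have := (mem_uncovered.1 hi).1
  rw [Finset.mem_insert, mem_uncovered, Finset.forall_mem_insert, Finset.mem_filter, mem_uncovered]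
  grind

end NoncrossingSets

theorem sum_card_filter_lt {α M : Type*} [LinearOrder α] [AddCommMonoid M] (g : ℕ → M)
    (S : Finset α) : ∑ i ∈ S, g {k ∈ S | k < i}.card = ∑ t ∈ Finset.range S.card, g t := by
  induction S using Finset.induction_on_max with
  | empty => simp
  | insert a S hmax ih =>
    have ha : a ∉ S := fun h => lt_irrefl a (hmax a h)
    rw [Finset.sum_insert ha, Finset.card_insert_of_notMem ha, Finset.sum_range_succ, ← ih,
      add_comm, Finset.filter_insert, if_neg (lt_irrefl a), Finset.filter_true_of_mem hmax]
    refine congrArg (· + _) (Finset.sum_congr rfl fun i hi => ?_)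
    rw [Finset.filter_insert, if_neg (hmax i hi).not_gt]

theorem sum_ballot_card_uncovered (n m : ℕ) :
    ∑ A ∈ ncSets n, ballot m (uncovered n A).card = ballot (n + m) 0 := by
  induction n generalizing m with
  | zero => simp [ncSets_zero, uncovered]
  | succ n ih =>
    rw [sum_ncSets_succ, show n + 1 + m = n + (m + 1) by ring, ← ih]
    refine Finset.sum_congr rfl fun A hA => ?_
    rw [ballot, Finset.sum_range_succ, ← sum_card_filter_lt, card_uncovered_succ hA]
    refine congrArg (· + _) (Finset.sum_congr rfl fun i hi => ?_)
    rw [card_uncovered_succ_insert hA hi]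

theorem card_ncSets (n : ℕ) : (ncSets n).card = catalan n := by
  simpa [ballot, ballot_zero_right] using sum_ballot_card_uncovered n 0

namespace NCP

variable {n : ℕ}

theorem arcs_injective : Function.Injective (NCP.arcs : NCP n → _) := by
  rintro ⟨A, _, _⟩ ⟨B, _, _⟩ rfl
  rfl

/-- The inclusion of arcs on `Fin n` into arcs on `ℕ`. -/
def arcEmb (n : ℕ) : Fin n × Fin n ↪ ℕ × ℕ := Fin.valEmbedding.prodMap Fin.valEmbedding

theorem map_arcs_mem_ncSets (lam : NCP n) : lam.arcs.map (arcEmb n) ∈ ncSets n := by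
  simp only [mem_ncSets, IsNC, Finset.forall_mem_map]
  exact ⟨fun p _ => p.2.isLt, fun p hp => lam.lt_of_mem hp,
    fun p hp q hq hpq => lam.noncrossing hp hq fun h => hpq (congrArg _ h)⟩

/-- The noncrossing partition with a given noncrossing set of arcs on `0, …, n - 1`. -/
noncomputable def ofMemNcSets {A : Finset (ℕ × ℕ)} (hA : A ∈ ncSets n) : NCP n where
  arcs := A.preimage (arcEmb n) (arcEmb n).injective.injOn
  lt_of_mem h := (mem_ncSets.1 hA).2.1 _ (Finset.mem_preimage.1 h)
  noncrossing h h' hne := (mem_ncSets.1 hA).2.2 _ (Finset.mem_preimage.1 h) _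
    (Finset.mem_preimage.1 h') ((arcEmb n).injective.ne hne)

/-- Noncrossing partitions as noncrossing sets of arcs on `0, …, n - 1`. -/
noncomputable def equivNcSets (n : ℕ) : NCP n ≃ ncSets n where
  toFun lam := ⟨lam.arcs.map (arcEmb n), lam.map_arcs_mem_ncSets⟩
  invFun A := ofMemNcSets A.2
  left_inv lam := arcs_injective (Finset.preimage_map _ _)
  right_inv A := by
    obtain ⟨hn, hord, -⟩ := mem_ncSets.1 A.2
    refine Subtype.ext ((Finset.map_eq_image _ _).trans
      (Finset.image_preimage_of_bij (arcEmb n) A.1 ⟨fun _ => id, (arcEmb n).injective.injOn, ?_⟩))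
    exact fun p hp => ⟨(⟨p.1, (hord p hp).trans (hn p hp)⟩, ⟨p.2, hn p hp⟩), hp, rfl⟩

theorem card_eq_catalan (n : ℕ) : Nat.card (NCP n) = catalan n := by
  rw [Nat.card_congr (equivNcSets n), Nat.card_eq_fintype_card, Fintype.card_coe, card_ncSets]

instance instFinite (n : ℕ) : Finite (NCP n) := Finite.of_injective _ arcs_injective

theorem mem_arcs_iff (lam : NCP n) (i j : Fin n) : (i, j) ∈ lam.arcs ↔ lam.Q j = i ∧ i < j := by
  constructor
  · exact fun h => ⟨qFun_of_mem h, lam.lt_of_mem h⟩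
  · rintro ⟨rfl, hlt⟩
    by_cases hex : ∃ i, (i, j) ∈ lam.arcs
    · obtain ⟨i, hi⟩ := hex
      rwa [show lam.Q j = i from qFun_of_mem hi]
    · have hle := (lam.component j).le_max' j (lam.self_mem_component j)
      rw [← qFun_of_not hex] at hle
      exact absurd hlt hle.not_gt

theorem Q_injective : Function.Injective (NCP.Q : NCP n → _) := by
  intro lam mu h
  refine arcs_injective (Finset.ext fun ⟨i, j⟩ => ?_)
  rw [mem_arcs_iff, mem_arcs_iff, h]

end NCP

theorem point_injective {n : ℕ} : Function.Injective (point : Equiv.Perm (Fin n) → _) := by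
  intro σ τ h
  ext j
  simpa [point] using congrFun h j

theorem card_image_point_QSV (n : ℕ) : Nat.card (point '' QSV n) = catalan n := by
  rw [QSV, ← Set.range_comp, Nat.card_range_of_injective (point_injective.comp NCP.Q_injective),
    NCP.card_eq_catalan]

/-! ### Vanishing ideals of finite sets of points -/

section VanishingIdeal

open MvPolynomial

variable {σ K : Type*} [Field K]

/-- Evaluation of polynomials at the points of `V`. -/
noncomputable def evalOn (V : Set (σ → K)) : MvPolynomial σ K →ₐ[K] V → K :=
  AlgHom.pi fun v => aeval v.1

theorem ker_evalOn (V : Set (σ → K)) : RingHom.ker (evalOn V) = vanishingIdeal K V := by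
  ext f
  simp [evalOn, RingHom.mem_ker, funext_iff, mem_vanishingIdeal_iff]

theorem vanishingIdeal_singleton_injective :
    Function.Injective fun x : σ → K => vanishingIdeal K {x} := by
  intro x y (h : vanishingIdeal K {x} = vanishingIdeal K {y})
  funext i
  have hx : (X i - C (x i) : MvPolynomial σ K) ∈ vanishingIdeal K {x} := by
    simp
  rw [h, mem_vanishingIdeal_singleton_iff] at hx
  simpa [sub_eq_zero, eq_comm] using hx

theorem evalOn_surjective (V : Set (σ → K)) [Finite V] : Function.Surjective (evalOn V) := by
  intro g
  have hcoprime : Pairwise fun v w : V =>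
      IsCoprime (vanishingIdeal K {v.1} : Ideal (MvPolynomial σ K)) (vanishingIdeal K {w.1}) :=
    fun v w hvw => Ideal.isCoprime_of_isMaximal fun h =>
      hvw (Subtype.ext (vanishingIdeal_singleton_injective h))
  obtain ⟨f, hf⟩ := Ideal.exists_forall_sub_mem_ideal hcoprime fun v => C (g v)
  refine ⟨f, funext fun v => ?_⟩
  simpa [mem_vanishingIdeal_singleton_iff, sub_eq_zero, evalOn] using hf v

theorem rank_quotient_vanishingIdeal (V : Set (σ → K)) [Finite V] :
    Module.rank K (MvPolynomial σ K ⧸ (vanishingIdeal K V : Ideal (MvPolynomial σ K))) =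
      Nat.card V := by
  have := Fintype.ofFinite V
  have e := (Ideal.quotientEquivAlgOfEq K (ker_evalOn V).symm).trans
    (Ideal.quotientKerAlgEquivOfSurjective (evalOn_surjective V))
  rw [e.toLinearEquiv.rank_eq, rank_fun', Nat.card_eq_fintype_card]

end VanishingIdeal

theorem rank_quotient_idealQSV (n : ℕ) :
    Module.rank ℚ (MvPolynomial (Fin n) ℚ ⧸ idealQSV n) = catalan n := by
  have : Finite (point '' QSV n) := ((Set.finite_range NCP.Q).image point).to_subtype
  rw [idealQSV, rank_quotient_vanishingIdeal, card_image_point_QSV]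

open MvPolynomial

/-! ### Bergeron–Sottile maps -/

section BergeronSottile

variable {R : Type*} [CommRing R] {n k : ℕ}

/-- The Bergeron–Sottile map `R_i`, which sets `x_i = 0` and renumbers the remaining variables. -/
noncomputable def bergeronSottile (i : Fin (n + 1)) :
    MvPolynomial (Fin (n + 1)) R →ₐ[R] MvPolynomial (Fin n) R :=
  killCompl (Fin.succAbove_right_injective (p := i))

theorem coeff_bergeronSottile (i : Fin (n + 1)) (f : MvPolynomial (Fin (n + 1)) R)
    (m : Fin n →₀ ℕ) : (bergeronSottile i f).coeff m = f.coeff (m.mapDomain i.succAbove) :=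
  coeff_killCompl ..

theorem bergeronSottile_X_self (i : Fin (n + 1)) :
    bergeronSottile i (X i : MvPolynomial (Fin (n + 1)) R) = 0 := by
  rw [bergeronSottile, killCompl, aeval_X, dif_neg]
  rintro ⟨j, hj⟩
  exact Fin.succAbove_ne i j hj

theorem bergeronSottile_X_succAbove (i : Fin (n + 1)) (j : Fin n) :
    bergeronSottile i (X (i.succAbove j) : MvPolynomial (Fin (n + 1)) R) = X j := by
  rw [bergeronSottile, ← rename_X, killCompl_rename_app]

theorem constantCoeff_bergeronSottile (i : Fin (n + 1)) (f : MvPolynomial (Fin (n + 1)) R) :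
    constantCoeff (bergeronSottile i f) = constantCoeff f := by
  rw [constantCoeff_eq, coeff_bergeronSottile, Finsupp.mapDomain_zero, constantCoeff_eq]

theorem coeff_bergeronSottile_sum_single (p : Fin (n + 1)) (f : MvPolynomial (Fin (n + 1)) R)
    (i : Fin k → Fin n) (a : Fin k → ℕ) :
    (bergeronSottile p f).coeff (∑ s, Finsupp.single (i s) (a s)) =
      f.coeff (∑ s, Finsupp.single (p.succAbove (i s)) (a s)) := by
  simp [coeff_bergeronSottile, Finsupp.mapDomain_finsetSum, Finsupp.mapDomain_single]

theorem exists_succAboveOrderEmb_comp_eq {p : Fin (n + 1)} {i : Fin k ↪o Fin (n + 1)}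
    (hp : p ∉ Set.range i) : ∃ t : Fin k ↪o Fin n, t.trans p.succAboveOrderEmb = i := by
  have hex (s) : ∃ t, p.succAbove t = i s := Fin.exists_succAbove_eq fun h => hp ⟨s, h⟩
  choose t ht using hex
  refine ⟨.ofStrictMono t fun a b hab => ?_, RelEmbedding.ext ht⟩
  rw [← (Fin.strictMono_succAbove p).lt_iff_lt, ht, ht]
  exact i.strictMono hab

theorem exists_eq_sum_single (m : Fin n →₀ ℕ) : ∃ (k : ℕ) (a : Fin k → ℕ) (i : Fin k ↪o Fin n),
    (∀ s, 0 < a s) ∧ m = ∑ s, Finsupp.single (i s) (a s) := by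
  let i := m.support.orderEmbOfFin rfl
  refine ⟨_, m ∘ i, i, fun s => Nat.pos_of_ne_zero ?_, ?_⟩
  · exact Finsupp.mem_support_iff.1 (m.support.orderEmbOfFin_mem rfl s)
  · have himage : m.support = Finset.univ.map i.toEmbedding := by simp [i]
    conv_lhs => rw [← m.sum_single, Finsupp.sum, himage, Finset.sum_map]
    rfl

variable {f : MvPolynomial (Fin (n + 1)) ℚ}

theorem IsQuasisymmetric.bergeronSottile_eq (hf : IsQuasisymmetric f) (p q : Fin (n + 1)) :
    bergeronSottile p f = bergeronSottile q f := by
  ext m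
  obtain ⟨k, a, i, ha, rfl⟩ := exists_eq_sum_single m
  simp only [coeff_bergeronSottile_sum_single]
  exact hf k a ha (i.trans p.succAboveOrderEmb) (i.trans q.succAboveOrderEmb)

theorem IsQuasisymmetric.bergeronSottile (hf : IsQuasisymmetric f) (p : Fin (n + 1)) :
    IsQuasisymmetric (bergeronSottile p f) := by
  intro k a ha i i'
  simp only [coeff_bergeronSottile_sum_single]
  exact hf k a ha (i.trans p.succAboveOrderEmb) (i'.trans p.succAboveOrderEmb)

theorem isQuasisymmetric_of_bergeronSottile_eq {g : MvPolynomial (Fin n) ℚ}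
    (hg : IsQuasisymmetric g) (h : ∀ i, QuasisymmetricVariety.bergeronSottile i f = g) :
    IsQuasisymmetric f := by
  intro k a ha i i'
  by_cases hk : k = n + 1
  · subst hk
    have hunique (i : Fin (n + 1) ↪o Fin (n + 1)) :=
      Finset.orderEmbOfFin_unique' (Finset.card_fin _) fun s => Finset.mem_univ (i s)
    rw [hunique i, hunique i']
  · have hcoeff (i : Fin k ↪o Fin (n + 1)) : ∃ t : Fin k ↪o Fin n,
        f.coeff (∑ s, Finsupp.single (i s) (a s)) = g.coeff (∑ s, Finsupp.single (t s) (a s)) := by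
      obtain ⟨p, hp⟩ : ∃ p, p ∉ Set.range i := by
        by_contra! hsurj
        exact hk (by simpa using Fintype.card_of_bijective ⟨i.injective, hsurj⟩)
      obtain ⟨t, rfl⟩ := exists_succAboveOrderEmb_comp_eq hp
      exact ⟨t, by rw [← h p, coeff_bergeronSottile_sum_single]; rfl⟩
    obtain ⟨t, ht⟩ := hcoeff i
    obtain ⟨t', ht'⟩ := hcoeff i'
    rw [ht, ht', hg k a ha t t']

end BergeronSottile

/-! ### Fundamental quasisymmetric polynomials -/

section Fundamental

variable {A : Type*} [CommSemiring A]

/-- The fundamental quasisymmetric polynomial of the composition `β`, evaluated at `x`; the parts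
of `β` are listed starting with the one that belongs to the last variables. The recursion splits
off the power `c` of the last variable, which uses up either a part of the first entry of `β` or
all of it. It also makes sense for lists `β` with entries `0`. -/
def fundamental : (j : ℕ) → (Fin j → A) → List ℕ → A
  | _, _, [] => 1
  | 0, _, _ :: _ => 0
  | j + 1, x, a :: β =>
    ∑ c ∈ Finset.range a, x (Fin.last j) ^ c * fundamental j (x ∘ Fin.castSucc) ((a - c) :: β) +
      x (Fin.last j) ^ a * fundamental j (x ∘ Fin.castSucc) β

variable {j : ℕ} (x : Fin (j + 1) → A) (a : ℕ) (β : List ℕ)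

theorem fundamental_nil {j : ℕ} (x : Fin j → A) : fundamental j x [] = 1 := by
  cases j <;> rfl

theorem fundamental_succ_cons : fundamental (j + 1) x (a :: β) =
    ∑ c ∈ Finset.range a, x (Fin.last j) ^ c * fundamental j (x ∘ Fin.castSucc) ((a - c) :: β) +
      x (Fin.last j) ^ a * fundamental j (x ∘ Fin.castSucc) β :=
  rfl

theorem fundamental_succ_zero_cons :
    fundamental (j + 1) x (0 :: β) = fundamental j (x ∘ Fin.castSucc) β := by
  simp [fundamental_succ_cons]

theorem fundamental_succ_succ_cons : fundamental (j + 1) x ((a + 1) :: β) =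
    fundamental j (x ∘ Fin.castSucc) ((a + 1) :: β) +
      x (Fin.last j) * fundamental (j + 1) x (a :: β) := by
  rw [fundamental_succ_cons, fundamental_succ_cons, Finset.sum_range_succ', mul_add,
    Finset.mul_sum]
  simp only [Nat.add_sub_add_right, pow_succ', mul_assoc, pow_zero, one_mul, Nat.sub_zero]
  ac_rfl

variable {β}

theorem map_fundamental {B : Type*} [CommSemiring B] (φ : A →+* B) {j : ℕ} (x : Fin j → A)
    (β : List ℕ) : φ (fundamental j x β) = fundamental j (φ ∘ x) β := by
  induction j generalizing β with
  | zero => cases β <;> simp [fundamental]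
  | succ j ih => cases β <;> simp [fundamental, ih, Function.comp_assoc]

theorem fundamental_mem (S : Subsemiring A) {j : ℕ} {x : Fin j → A} (hx : ∀ l, x l ∈ S)
    (β : List ℕ) : fundamental j x β ∈ S := by
  induction j generalizing β with
  | zero => cases β <;> simp [fundamental]
  | succ j ih =>
    cases β with
    | nil => rw [fundamental_nil]; exact one_mem S
    | cons a β =>
      have ih (β) : fundamental j (x ∘ Fin.castSucc) β ∈ S := ih (fun l => hx l.castSucc) β
      exact add_mem (sum_mem fun c _ => mul_mem (pow_mem (hx _) c) (ih _))
        (mul_mem (pow_mem (hx _) a) (ih _))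

theorem fundamental_succ_of_last_eq_zero {x : Fin (j + 1) → A} (hx : x (Fin.last j) = 0)
    (hβ : ∀ b ∈ β, 0 < b) : fundamental (j + 1) x β = fundamental j (x ∘ Fin.castSucc) β := by
  cases β with
  | nil => rw [fundamental_nil, fundamental_nil]
  | cons a β =>
    obtain ⟨a, rfl⟩ := Nat.exists_eq_succ_of_ne_zero (hβ a List.mem_cons_self).ne'
    rw [fundamental_succ_succ_cons, hx, zero_mul, add_zero]

theorem fundamental_zero_left {j : ℕ} (hβ : ∀ b ∈ β, 0 < b) (hne : β ≠ []) :
    fundamental j (0 : Fin j → A) β = 0 := by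
  induction j with
  | zero =>
    obtain ⟨a, β, rfl⟩ := List.exists_cons_of_ne_nil hne
    rfl
  | succ j ih => exact (fundamental_succ_of_last_eq_zero rfl hβ).trans ih

theorem fundamental_succ_of_eq_zero {x : Fin (j + 1) → A} {k : Fin (j + 1)} (hx : x k = 0)
    (hβ : ∀ b ∈ β, 0 < b) : fundamental (j + 1) x β = fundamental j (x ∘ k.succAbove) β := by
  induction j generalizing β with
  | zero =>
    obtain rfl : k = Fin.last 0 := Fin.eq_zero k
    rw [fundamental_succ_of_last_eq_zero hx hβ, Fin.succAbove_last]
  | succ j ih =>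
    cases k using Fin.lastCases with
    | last => rw [fundamental_succ_of_last_eq_zero hx hβ, Fin.succAbove_last]
    | cast k =>
      cases β with
      | nil => rw [fundamental_nil, fundamental_nil]
      | cons a β =>
        have ih (β : List ℕ) (hβ : ∀ b ∈ β, 0 < b) : fundamental (j + 1) (x ∘ Fin.castSucc) β =
            fundamental j ((x ∘ k.castSucc.succAbove) ∘ Fin.castSucc) β := by
          rw [ih hx hβ]
          congr 1
          funext l
          simp [Fin.castSucc_succAbove_castSucc]
        obtain ⟨-, hβ⟩ := List.forall_mem_cons.1 hβ
        rw [fundamental_succ_cons, fundamental_succ_cons, ih β hβ, Function.comp_apply,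
          Fin.succAbove_castSucc_of_le _ _ k.le_last, Fin.succ_last]
        congr 1
        refine Finset.sum_congr rfl fun c hc => ?_
        rw [ih _ (List.forall_mem_cons.2 ⟨Nat.sub_pos_of_lt (Finset.mem_range.1 hc), hβ⟩)]

end Fundamental

theorem isQuasisymmetric_fundamental (n : ℕ) {β : List ℕ} (hβ : ∀ a ∈ β, 0 < a) :
    IsQuasisymmetric (fundamental n X β) := by
  induction n with
  | zero =>
    intro k a _ i i'
    congr 2 with s
    exact (i s).elim0
  | succ n ih =>
    refine isQuasisymmetric_of_bergeronSottile_eq ih fun i => ?_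
    have hX : (bergeronSottile i ∘ X) ∘ i.succAbove = (X : Fin n → MvPolynomial (Fin n) ℚ) :=
      funext (bergeronSottile_X_succAbove i)
    rw [← hX, ← fundamental_succ_of_eq_zero (bergeronSottile_X_self i) hβ]
    exact map_fundamental (bergeronSottile i).toRingHom _ _

theorem fundamental_mem_idealQSymPlus (n : ℕ) {β : List ℕ} (hβ : ∀ a ∈ β, 0 < a) (hne : β ≠ []) :
    fundamental n X β ∈ idealQSymPlus n := by
  refine Ideal.subset_span ⟨isQuasisymmetric_fundamental n hβ, ?_⟩
  rw [map_fundamental, ← fundamental_zero_left hβ hne]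
  exact congrArg (fundamental n · β) (funext (constantCoeff_X ℚ))

/-! ### Spanning by the subdiagonal monomials -/

section Transdiagonal

/-- A list of numbers is transdiagonal if one of its nonempty prefixes has at least its length as
sum. -/
def Transdiagonal (L : List ℕ) : Prop := ∃ p, p <+: L ∧ p ≠ [] ∧ p.length ≤ p.sum

variable {T β : List ℕ}

theorem Transdiagonal.of_append_zero_cons (h : Transdiagonal (T ++ 0 :: β)) :
    Transdiagonal (T ++ β) := by
  obtain ⟨p, ⟨r, hr⟩, hne, hle⟩ := h
  rcases List.append_eq_append_iff.1 hr with ⟨t, rfl, -⟩ | ⟨_ | ⟨b, t⟩, rfl, ht⟩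
  · exact ⟨p, by simp, hne, hle⟩
  · exact ⟨T, List.prefix_append T β, by simpa using hne, by simpa using hle⟩
  · obtain ⟨rfl, rfl⟩ := List.cons.inj ht
    simp only [List.length_append, List.length_cons, List.sum_append, List.sum_cons] at hle
    refine ⟨T ++ t, by simp, ?_, by simp; omega⟩
    rintro h
    obtain ⟨rfl, rfl⟩ := List.append_eq_nil_iff.1 h
    simp at hle

theorem Transdiagonal.of_append_zero_succ_cons {a : ℕ}
    (h : Transdiagonal (T ++ 0 :: (a + 1) :: β)) : Transdiagonal (T ++ a :: β) := by
  obtain ⟨p, ⟨r, hr⟩, hne, hle⟩ := h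
  rcases List.append_eq_append_iff.1 hr with ⟨t, rfl, -⟩ | ⟨_ | ⟨b, _ | ⟨c, t⟩⟩, rfl, ht⟩
  · exact ⟨p, by simp, hne, hle⟩
  · exact ⟨T, List.prefix_append T _, by simpa using hne, by simpa using hle⟩
  · obtain ⟨rfl, -⟩ := List.cons.inj ht
    simp only [List.length_append, List.length_singleton, List.sum_append, List.sum_singleton]
      at hle
    refine ⟨T, List.prefix_append T _, ?_, by omega⟩
    rintro rfl
    simp at hle
  · simp only [List.cons_append, List.cons.injEq] at ht
    obtain ⟨rfl, rfl, rfl⟩ := ht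
    simp only [List.length_append, List.length_cons, List.sum_append, List.sum_cons] at hle
    exact ⟨T ++ a :: t, by simp, by simp, by simp; omega⟩

end Transdiagonal

section Spanning

variable {n j : ℕ} {m w : Fin n →₀ ℕ}

/-- The entries of `w` at the positions `≥ j`, starting with the last one. -/
def topEntries (j : ℕ) (w : Fin n →₀ ℕ) : List ℕ := ((List.ofFn w).drop j).reverse

theorem topEntries_self (w : Fin n →₀ ℕ) : topEntries n w = [] := by
  simp [topEntries]

theorem topEntries_eq_append (hj : j < n) (w : Fin n →₀ ℕ) :
    topEntries j w = topEntries (j + 1) w ++ [w ⟨j, hj⟩] := by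
  rw [topEntries, topEntries, List.drop_eq_getElem_cons (by simpa using hj), List.reverse_cons,
    List.getElem_ofFn]

theorem sum_drop_ofFn {n : ℕ} (w : Fin n → ℕ) (i : Fin n) :
    ((List.ofFn w).drop i).sum = tailSum w i := by
  induction n with
  | zero => exact i.elim0
  | succ n ih =>
    rw [List.ofFn_succ]
    cases i using Fin.cases with
    | zero => simp [tailSum, List.sum_ofFn, Fin.sum_univ_succ]
    | succ i => simp [ih, tailSum, Finset.sum_filter, Fin.sum_univ_succ]

theorem transdiagonal_topEntries (hw : ¬ SubDiag n 0 w) : Transdiagonal (topEntries 0 w) := by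
  simp only [SubDiag, not_forall, not_lt, add_zero] at hw
  obtain ⟨i, hi⟩ := hw
  refine ⟨((List.ofFn w).drop i).reverse, ?_, ?_, ?_⟩
  · exact List.reverse_prefix.2 (List.drop_suffix i _)
  · simp
  · rw [List.length_reverse, List.length_drop, List.length_ofFn, List.sum_reverse, sum_drop_ofFn]
    omega

/-- The exponent `m` is smaller than `w` in the lexicographic order in which the last position is
the most significant one, and a position `≥ j` decides the comparison. -/
def LexBelow (j : ℕ) (m w : Fin n →₀ ℕ) : Prop :=
  ∃ i : Fin n, j ≤ i ∧ m i < w i ∧ ∀ l, i < l → m l = w l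

theorem wellFounded_lexBelow : WellFounded (LexBelow (n := n) 0) := by
  have h : WellFounded (Pi.Lex (fun a b : Fin n => b < a) fun {_} (x y : ℕ) => x < y) :=
    Pi.Lex.wellFounded _ fun _ => wellFounded_lt
  refine Subrelation.wf ?_ (InvImage.wf (fun m : Fin n →₀ ℕ => (m : Fin n → ℕ)) h)
  rintro m w ⟨i, _, hi, hl⟩
  exact ⟨i, hl, hi⟩

theorem LexBelow.of_le {j' : ℕ} (hj : j ≤ j') (h : LexBelow j' m w) : LexBelow j m w :=
  h.imp fun _ hi => ⟨hj.trans hi.1, hi.2⟩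

theorem LexBelow.succ_of_eq_zero (hj : j < n) (hw : w ⟨j, hj⟩ = 0) (h : LexBelow j m w) :
    LexBelow (j + 1) m w := by
  obtain ⟨i, hji, hi, hl⟩ := h
  refine ⟨i, hji.lt_of_ne ?_, hi, hl⟩
  rintro rfl
  exact Nat.not_lt_zero _ (hw ▸ hi)

theorem LexBelow.add_left {u : Fin n →₀ ℕ} (hu : ∀ l : Fin n, j ≤ l → u l = 0)
    (h : LexBelow j m w) : LexBelow j (u + m) w := by
  obtain ⟨i, hji, hi, hl⟩ := h
  refine ⟨i, hji, ?_, fun l hil => ?_⟩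
  · rwa [Finsupp.add_apply, hu i hji, zero_add]
  · rw [Finsupp.add_apply, hu l (hji.trans hil.le), zero_add, hl l hil]

/-- The span of the monomials whose exponents are `LexBelow j` of `w`. -/
noncomputable def lexLow (j : ℕ) (w : Fin n →₀ ℕ) : Submodule ℚ (MvPolynomial (Fin n) ℚ) :=
  restrictSupport ℚ {m | LexBelow j m w}

/-- The polynomials that agree modulo `idealQSymPlus n` with a combination of monomials whose
exponents are `LexBelow j` of `w`. -/
noncomputable def modLex (j : ℕ) (w : Fin n →₀ ℕ) : Submodule ℚ (MvPolynomial (Fin n) ℚ) :=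
  (idealQSymPlus n).restrictScalars ℚ ⊔ lexLow j w

/-- The monomial `x ^ w` with the variables at the positions `< j` removed. -/
noncomputable def topMonomial (j : ℕ) (w : Fin n →₀ ℕ) : MvPolynomial (Fin n) ℚ :=
  monomial (w.filter fun l : Fin n => j ≤ l) 1

theorem modLex_anti {j' : ℕ} (hj : j ≤ j') : modLex j' w ≤ modLex j w :=
  sup_le_sup_left (restrictSupport_mono ℚ fun _ h => h.of_le hj) _

theorem modLex_le_succ_of_eq_zero (hj : j < n) (hw : w ⟨j, hj⟩ = 0) :
    modLex j w ≤ modLex (j + 1) w :=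
  sup_le_sup_left (restrictSupport_mono ℚ fun _ h => h.succ_of_eq_zero hj hw) _

open scoped Pointwise in
theorem mul_mem_lexLow {f g : MvPolynomial (Fin n) ℚ} (hg : g ∈ supported ℚ {l : Fin n | l < j})
    (hf : f ∈ lexLow j w) : g * f ∈ lexLow j w := by
  have hsubset : {u : Fin n →₀ ℕ | ∀ l : Fin n, j ≤ l → u l = 0} + {m | LexBelow j m w} ⊆
      {m | LexBelow j m w} := by
    rintro _ ⟨u, hu, m, hm, rfl⟩
    exact LexBelow.add_left hu hm
  refine restrictSupport_mono ℚ hsubset ?_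
  rw [restrictSupport_add]
  refine Submodule.mul_mem_mul ((mem_restrictSupport_iff ..).2 fun u hu l hl => ?_) hf
  by_contra hne
  have hvars : l ∈ g.vars :=
    (mem_vars_iff_mem_support l).2 ⟨u, hu, Finsupp.mem_support_iff.2 hne⟩
  exact hl.not_gt (mem_supported.1 hg hvars)

theorem mul_mem_modLex {f g : MvPolynomial (Fin n) ℚ} (hg : g ∈ supported ℚ {l : Fin n | l < j})
    (hf : f ∈ modLex j w) : g * f ∈ modLex j w := by
  obtain ⟨a, ha, b, hb, rfl⟩ := Submodule.mem_sup.1 hf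
  rw [mul_add]
  exact Submodule.add_mem_sup (Ideal.mul_mem_left _ g ha) (mul_mem_lexLow hg hb)

theorem topMonomial_eq_mul (hj : j < n) (w : Fin n →₀ ℕ) :
    topMonomial j w = X ⟨j, hj⟩ ^ w ⟨j, hj⟩ * topMonomial (j + 1) w := by
  rw [topMonomial, topMonomial, X_pow_eq_monomial, monomial_mul, one_mul]
  congr 2
  ext l
  rw [Finsupp.add_apply, Finsupp.filter_apply, Finsupp.filter_apply, Finsupp.single_apply]
  rcases lt_trichotomy j l with h | rfl | h
  · rw [if_pos h.le, if_neg (Fin.ne_of_lt h), if_pos (Nat.succ_le_of_lt h), zero_add]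
  · simp
  · rw [if_neg h.not_ge, if_neg (Fin.ne_of_gt h), if_neg (by omega), zero_add]

theorem topMonomial_of_eq_zero (hj : j < n) (hw : w ⟨j, hj⟩ = 0) :
    topMonomial j w = topMonomial (j + 1) w := by
  rw [topMonomial_eq_mul hj, hw, pow_zero, one_mul]

theorem X_pow_mul_topMonomial_mem_lexLow (hj : j < n) {c : ℕ} (hc : c < w ⟨j, hj⟩) :
    X ⟨j, hj⟩ ^ c * topMonomial (j + 1) w ∈ lexLow j w := by
  rw [topMonomial, X_pow_eq_monomial, monomial_mul, one_mul]
  refine (monomial_mem_restrictSupport ..).2 (Or.inl ⟨⟨j, hj⟩, le_rfl, ?_, fun l hl => ?_⟩)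
  · simpa using hc
  · rw [Finsupp.add_apply, Finsupp.single_eq_of_ne hl.ne', zero_add]
    exact Finsupp.filter_apply_pos _ _ hl

/-- The polynomial `fundamental j x β` in the variables `x` of `MvPolynomial (Fin n) ℚ` at the
positions `< j`. -/
noncomputable def fundamentalBelow (hj : j ≤ n) (β : List ℕ) : MvPolynomial (Fin n) ℚ :=
  fundamental j (X ∘ Fin.castLE hj) β

theorem fundamentalBelow_mem_supported (hj : j ≤ n) (β : List ℕ) :
    fundamentalBelow hj β ∈ supported ℚ {l : Fin n | l < j} :=
  fundamental_mem (supported ℚ {l : Fin n | l < j}).toSubsemiring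
    (fun l => X_mem_supported.2 l.is_lt) β

/-- Multiplying out `fundamentalBelow hj (w j :: β)` by its recursion gives the monomial `w` in
the top variables from the last term, and lexicographically smaller ones from the others. -/
theorem topMonomial_mul_fundamentalBelow_mem_of_cons (hj : j < n) {β : List ℕ}
    (h : topMonomial (j + 1) w * fundamentalBelow hj (w ⟨j, hj⟩ :: β) ∈ modLex (j + 1) w) :
    topMonomial j w * fundamentalBelow hj.le β ∈ modLex j w := by
  have hrec : fundamentalBelow hj (w ⟨j, hj⟩ :: β) =
      ∑ c ∈ Finset.range (w ⟨j, hj⟩),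
        X ⟨j, hj⟩ ^ c * fundamentalBelow hj.le ((w ⟨j, hj⟩ - c) :: β) +
      X ⟨j, hj⟩ ^ w ⟨j, hj⟩ * fundamentalBelow hj.le β :=
    fundamental_succ_cons ..
  have h := modLex_anti j.le_succ h
  rw [hrec, mul_add, mul_left_comm, ← mul_assoc, ← topMonomial_eq_mul, Finset.mul_sum] at h
  refine (Submodule.add_mem_iff_right _ (sum_mem fun c hc => Submodule.mem_sup_right ?_)).1 h
  rw [← mul_assoc, mul_comm, mul_comm (topMonomial _ _)]
  exact mul_mem_lexLow (fundamentalBelow_mem_supported hj.le _)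
    (X_pow_mul_topMonomial_mem_lexLow hj (Finset.mem_range.1 hc))

theorem topMonomial_mul_fundamentalBelow_mem_of_eq_zero (hj : j < n) (hw : w ⟨j, hj⟩ = 0) {a : ℕ}
    {β : List ℕ}
    (h₁ : topMonomial (j + 1) w * fundamentalBelow hj ((a + 1) :: β) ∈ modLex (j + 1) w)
    (h₂ : topMonomial (j + 1) w * fundamentalBelow hj (a :: β) ∈ modLex (j + 1) w) :
    topMonomial j w * fundamentalBelow hj.le ((a + 1) :: β) ∈ modLex j w := by
  have hrec : fundamentalBelow hj ((a + 1) :: β) =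
      fundamentalBelow hj.le ((a + 1) :: β) + X ⟨j, hj⟩ * fundamentalBelow hj (a :: β) :=
    fundamental_succ_succ_cons ..
  have hX : (X ⟨j, hj⟩ : MvPolynomial (Fin n) ℚ) ∈ supported ℚ {l : Fin n | l < j + 1} :=
    X_mem_supported.2 j.lt_succ_self
  rw [topMonomial_of_eq_zero hj hw, ← add_sub_cancel_right (fundamentalBelow hj.le _), ← hrec,
    mul_sub, mul_left_comm]
  exact modLex_anti j.le_succ (sub_mem h₁ (mul_mem_modLex hX h₂))

theorem topMonomial_mul_fundamentalBelow_mem_modLex (hj : j ≤ n) {β : List ℕ}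
    (hβ : ∀ b ∈ β, 0 < b) (h : Transdiagonal (topEntries j w ++ β)) :
    topMonomial j w * fundamentalBelow hj β ∈ modLex j w := by
  induction hj using Nat.decreasingInduction generalizing β with
  | self =>
    refine Submodule.mem_sup_left (Ideal.mul_mem_left _ _ (fundamental_mem_idealQSymPlus n hβ ?_))
    rintro rfl
    obtain ⟨p, hp, hne, -⟩ := h
    rw [topEntries_self, List.append_nil, List.prefix_nil] at hp
    exact hne hp
  | of_succ j hj ih =>
    rcases (w ⟨j, hj⟩).eq_zero_or_pos with hw | hw
    · rw [topEntries_eq_append hj, hw, List.append_assoc, List.singleton_append] at h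
      induction β with
      | nil =>
        have := ih hβ h.of_append_zero_cons
        rw [fundamentalBelow, fundamental_nil] at this ⊢
        rw [topMonomial_of_eq_zero hj hw]
        exact modLex_anti j.le_succ this
      | cons a β ihβ =>
        obtain ⟨ha, hβ'⟩ := List.forall_mem_cons.1 hβ
        obtain ⟨a, rfl⟩ := Nat.exists_eq_add_one.2 ha
        refine topMonomial_mul_fundamentalBelow_mem_of_eq_zero hj hw (ih hβ h.of_append_zero_cons)
          ?_
        have h := h.of_append_zero_succ_cons
        rcases a.eq_zero_or_pos with rfl | ha
        · rw [fundamentalBelow, fundamental_succ_zero_cons, ← topMonomial_of_eq_zero hj hw]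
          exact modLex_le_succ_of_eq_zero hj hw (ihβ hβ' h)
        · exact ih (List.forall_mem_cons.2 ⟨ha, hβ'⟩) h
    · refine topMonomial_mul_fundamentalBelow_mem_of_cons hj
        (ih (List.forall_mem_cons.2 ⟨hw, hβ⟩) ?_)
      rwa [topEntries_eq_append hj, List.append_assoc] at h

theorem monomial_mem_modLex (hw : ¬ SubDiag n 0 w) : monomial w 1 ∈ modLex 0 w := by
  have h := topMonomial_mul_fundamentalBelow_mem_modLex n.zero_le (β := [])
    (List.forall_mem_nil _) (by simpa using transdiagonal_topEntries hw)
  rw [fundamentalBelow, fundamental_nil, mul_one, topMonomial] at h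
  rwa [(Finsupp.filter_eq_self_iff (fun l : Fin n => 0 ≤ (l : ℕ)) w).2 fun l _ => l.1.zero_le] at h

/-- The polynomials spanned by the monomials with subdiagonal exponent sequence. -/
noncomputable def subDiagPoly (n : ℕ) : Submodule ℚ (MvPolynomial (Fin n) ℚ) :=
  restrictSupport ℚ {w | SubDiag n 0 w}

theorem idealQSymPlus_sup_subDiagPoly (n : ℕ) :
    (idealQSymPlus n).restrictScalars ℚ ⊔ subDiagPoly n = ⊤ := by
  have hmonomial (w : Fin n →₀ ℕ) :
      monomial w 1 ∈ (idealQSymPlus n).restrictScalars ℚ ⊔ subDiagPoly n := by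
    induction w using wellFounded_lexBelow.induction with
    | _ w ih =>
      by_cases hw : SubDiag n 0 w
      · exact Submodule.mem_sup_right ((monomial_mem_restrictSupport _).2 (Or.inl hw))
      · refine (sup_le le_sup_left ?_ : modLex 0 w ≤ _) (monomial_mem_modLex hw)
        rw [lexLow, restrictSupport_eq_span, Submodule.span_le]
        rintro _ ⟨m, hm, rfl⟩
        exact ih m hm
  rw [eq_top_iff, ← restrictSupport_univ, restrictSupport_eq_span, Submodule.span_le]
  rintro _ ⟨w, -, rfl⟩
  exact hmonomial w

end Spanning

/-! ### Independence of the subdiagonal monomials -/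

section Independence

theorem X_dvd_bergeronSottile_sub {R : Type*} [CommRing R] {n : ℕ} (i : Fin n)
    (f : MvPolynomial (Fin (n + 1)) R) :
    X i ∣ bergeronSottile i.succ f - bergeronSottile i.castSucc f := by
  let π := Ideal.Quotient.mkₐ R (Ideal.span {(X i : MvPolynomial (Fin n) R)})
  have hπ : π (X i) = 0 := Ideal.Quotient.eq_zero_iff_mem.2 (Ideal.mem_span_singleton_self _)
  suffices h : π.comp (bergeronSottile i.succ) = π.comp (bergeronSottile i.castSucc) from
    Ideal.mem_span_singleton.1 (Ideal.Quotient.eq.1 (DFunLike.congr_fun h f))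
  ext1 l
  rw [AlgHom.comp_apply, AlgHom.comp_apply]
  rcases eq_or_ne l i.succ with rfl | hl
  · conv_rhs => rw [← Fin.succAbove_castSucc_self i]
    rw [bergeronSottile_X_self, bergeronSottile_X_succAbove, hπ, map_zero]
  obtain ⟨t, rfl⟩ := Fin.exists_succAbove_eq hl
  rw [bergeronSottile_X_succAbove]
  rcases lt_trichotomy t i with hti | rfl | hit
  · rw [Fin.succAbove_succ_of_le i t hti.le, ← Fin.succAbove_castSucc_of_lt i t hti,
      bergeronSottile_X_succAbove]
  · rw [Fin.succAbove_succ_self, bergeronSottile_X_self, hπ, map_zero]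
  · rw [Fin.succAbove_succ_of_lt i t hit, ← Fin.succAbove_castSucc_of_le i t hit.le,
      bergeronSottile_X_succAbove]

variable {n : ℕ}

theorem bergeronSottile_mem_idealQSymPlus (p : Fin (n + 1)) {f : MvPolynomial (Fin (n + 1)) ℚ}
    (hf : f ∈ idealQSymPlus (n + 1)) : bergeronSottile p f ∈ idealQSymPlus n := by
  have hle : idealQSymPlus (n + 1) ≤ (idealQSymPlus n).comap (bergeronSottile p) :=
    Ideal.span_le.2 fun g hg => Ideal.subset_span
      ⟨hg.1.bergeronSottile p, (constantCoeff_bergeronSottile p g).trans hg.2⟩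
  exact hle hf

/-- This is the stability of the ideals under the quasisymmetric divided differences
`f ↦ (R_{i+1} f - R_i f) / x_i`, which satisfy a twisted Leibniz rule. -/
theorem exists_bergeronSottile_sub_eq (i : Fin n) {f : MvPolynomial (Fin (n + 1)) ℚ}
    (hf : f ∈ idealQSymPlus (n + 1)) :
    ∃ q ∈ idealQSymPlus n, bergeronSottile i.succ f - bergeronSottile i.castSucc f = X i * q := by
  induction hf using Submodule.span_induction with
  | mem g hg =>
    refine ⟨0, zero_mem _, ?_⟩
    rw [hg.1.bergeronSottile_eq i.succ i.castSucc, sub_self, mul_zero]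
  | zero => exact ⟨0, zero_mem _, by simp⟩
  | add g h _ _ hg hh =>
    obtain ⟨q, hq, hgq⟩ := hg
    obtain ⟨r, hr, hhr⟩ := hh
    exact ⟨q + r, add_mem hq hr, by rw [map_add, map_add, add_sub_add_comm, hgq, hhr, mul_add]⟩
  | smul h g hg' hg =>
    obtain ⟨q, hq, hgq⟩ := hg
    obtain ⟨r, hr⟩ := X_dvd_bergeronSottile_sub i h
    refine ⟨bergeronSottile i.succ h * q + r * bergeronSottile i.castSucc g,
      add_mem (Ideal.mul_mem_left _ _ hq)
        (Ideal.mul_mem_left _ _ (bergeronSottile_mem_idealQSymPlus _ hg')), ?_⟩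
    rw [smul_eq_mul, map_mul, map_mul, mul_add, mul_left_comm, ← hgq, ← mul_assoc, ← hr]
    ring

theorem tailSum_mapDomain_succAbove (p : Fin (n + 1)) (m : Fin n →₀ ℕ) (t : Fin n) :
    tailSum (m.mapDomain p.succAbove) (p.succAbove t) = tailSum m t := by
  have hp : m.mapDomain p.succAbove p = 0 :=
    Finsupp.mapDomain_of_notMem_range _ _ fun ⟨l, hl⟩ => Fin.succAbove_ne p l hl
  simp only [tailSum, Finset.sum_filter]
  rw [Fin.sum_univ_succAbove _ p, hp, ite_self, zero_add]
  simp only [Fin.succAbove_le_succAbove_iff,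
    Finsupp.mapDomain_apply (Fin.succAbove_right_injective (p := p))]

theorem SubDiag.of_succAbove {i : Fin n} {p : Fin (n + 1)} (hp : p ≤ i.succ) {m : Fin n →₀ ℕ}
    (h : SubDiag (n + 1) 0 ((m + Finsupp.single i 1).mapDomain p.succAbove)) :
    SubDiag n 0 m := by
  intro t
  have ht := h (p.succAbove t)
  have htail : tailSum (m + Finsupp.single i 1 : Fin n →₀ ℕ) t =
      tailSum m t + if t ≤ i then 1 else 0 := by
    simp [tailSum, Finset.sum_add_distrib, Finset.sum_filter, Finsupp.single_apply]
  rw [tailSum_mapDomain_succAbove, htail] at ht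
  split_ifs at ht with hti
  · have : (t : ℕ) ≤ p.succAbove t := by
      rw [Fin.succAbove]
      split_ifs <;> simp
    omega
  · rw [Fin.succAbove_of_le_castSucc p t (hp.trans (Fin.succ_le_castSucc_iff.2 (not_le.1 hti))),
      Fin.val_succ] at ht
    omega

theorem coeff_eq_zero_of_bergeronSottile_eq {f : MvPolynomial (Fin (n + 1)) ℚ}
    (hf : f ∈ subDiagPoly (n + 1)) (h : bergeronSottile (Fin.last n) f = bergeronSottile 0 f)
    {p : Fin (n + 1)} {w : Fin (n + 1) →₀ ℕ} (hw : w p ≠ 0) : f.coeff w = 0 := by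
  have hlast {w : Fin (n + 1) →₀ ℕ} (hw : w (Fin.last n) ≠ 0) : f.coeff w = 0 := by
    by_contra hne
    have hsub : SubDiag (n + 1) 0 w := hf (mem_support_iff.2 hne)
    have := hsub (Fin.last n)
    rw [tailSum_last, Fin.val_last] at this
    omega
  induction p using Fin.reverseInduction generalizing w with
  | last => exact hlast hw
  | cast i ih =>
    by_cases hw' : w (Fin.last n) = 0
    · obtain ⟨m, rfl⟩ : ∃ m : Fin n →₀ ℕ, m.mapDomain (Fin.last n).succAbove = w := by
        refine ⟨_, Finsupp.mapDomain_comapDomain _ Fin.succAbove_right_injective w fun l hl => ?_⟩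
        refine Fin.exists_succAbove_eq ?_
        rintro rfl
        exact Finsupp.mem_support_iff.1 hl hw'
      rw [← Fin.succAbove_last_apply,
        Finsupp.mapDomain_apply Fin.succAbove_right_injective] at hw
      rw [← coeff_bergeronSottile, h, coeff_bergeronSottile]
      apply ih
      rwa [← Fin.succAbove_zero_apply, Finsupp.mapDomain_apply Fin.succAbove_right_injective]
    · exact hlast hw'

theorem constantCoeff_eq_zero_of_mem_idealQSymPlus {f : MvPolynomial (Fin n) ℚ}
    (hf : f ∈ idealQSymPlus n) : constantCoeff f = 0 :=
  (Ideal.span_le.2 fun _ hg => hg.2 : idealQSymPlus n ≤ RingHom.ker constantCoeff) hf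

theorem mem_subDiagPoly_of_bergeronSottile_sub_eq {f : MvPolynomial (Fin (n + 1)) ℚ}
    (hf : f ∈ subDiagPoly (n + 1)) {i : Fin n} {q : MvPolynomial (Fin n) ℚ}
    (hq : bergeronSottile i.succ f - bergeronSottile i.castSucc f = X i * q) :
    q ∈ subDiagPoly n := by
  intro m hm
  have hcoeff : (bergeronSottile i.succ f - bergeronSottile i.castSucc f).coeff
      (m + Finsupp.single i 1) ≠ 0 := by
    rw [hq, add_comm, coeff_X_mul]
    exact mem_support_iff.1 hm
  rw [coeff_sub, coeff_bergeronSottile, coeff_bergeronSottile] at hcoeff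
  rcases ne_or_eq (f.coeff ((m + Finsupp.single i 1).mapDomain i.succ.succAbove)) 0 with h | h
  · exact SubDiag.of_succAbove le_rfl (hf (mem_support_iff.2 h))
  · rw [h, zero_sub, neg_ne_zero] at hcoeff
    exact SubDiag.of_succAbove i.castSucc_lt_succ.le (hf (mem_support_iff.2 hcoeff))

theorem eq_zero_of_mem_subDiagPoly {f : MvPolynomial (Fin n) ℚ} (hf : f ∈ idealQSymPlus n)
    (hs : f ∈ subDiagPoly n) : f = 0 := by
  induction n with
  | zero =>
    ext w
    rw [Subsingleton.elim w 0, coeff_zero]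
    exact constantCoeff_eq_zero_of_mem_idealQSymPlus hf
  | succ n ih =>
    have hsucc (i : Fin n) : bergeronSottile i.succ f = bergeronSottile i.castSucc f := by
      obtain ⟨q, hq, heq⟩ := exists_bergeronSottile_sub_eq i hf
      rw [ih hq (mem_subDiagPoly_of_bergeronSottile_sub_eq hs heq), mul_zero] at heq
      exact sub_eq_zero.1 heq
    have hlast : bergeronSottile (Fin.last n) f = bergeronSottile 0 f :=
      (Fin.last n).induction (motive := fun p => bergeronSottile p f = bergeronSottile 0 f) rfl
        fun i hi => (hsucc i).trans hi
    ext w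
    rw [coeff_zero]
    rcases eq_or_ne w 0 with rfl | hw
    · exact constantCoeff_eq_zero_of_mem_idealQSymPlus hf
    · obtain ⟨p, hp⟩ := Finsupp.ne_iff.1 hw
      exact coeff_eq_zero_of_bergeronSottile_eq hs hlast hp

end Independence

section Rank

theorem isCompl_idealQSymPlus_subDiagPoly (n : ℕ) :
    IsCompl ((idealQSymPlus n).restrictScalars ℚ) (subDiagPoly n) :=
  ⟨Submodule.disjoint_def.2 fun _ => eq_zero_of_mem_subDiagPoly,
    codisjoint_iff.2 (idealQSymPlus_sup_subDiagPoly n)⟩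

theorem rank_subDiagPoly (n : ℕ) : Module.rank ℚ (subDiagPoly n) = (catalan n : Cardinal) := by
  let e : {w : Fin n →₀ ℕ | SubDiag n 0 w} ≃ {w : Fin n → ℕ // SubDiag n 0 w} :=
    Finsupp.equivFunOnFinite.subtypeEquiv fun _ => Iff.rfl
  have : Finite {w : Fin n →₀ ℕ | SubDiag n 0 w} := Finite.of_equiv _ e.symm
  rw [subDiagPoly, ← (basisRestrictSupport ℚ {w : Fin n →₀ ℕ | SubDiag n 0 w}).mk_eq_rank'',
    ← Nat.cast_card, Nat.card_congr e, card_subDiag, ballot_zero_right]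

theorem rank_quotient_idealQSymPlus (n : ℕ) :
    Module.rank ℚ (MvPolynomial (Fin n) ℚ ⧸ idealQSymPlus n) = (catalan n : Cardinal) := by
  let e := (Submodule.Quotient.restrictScalarsEquiv ℚ (idealQSymPlus n)).symm ≪≫ₗ
    Submodule.quotientEquivOfIsCompl _ _ (isCompl_idealQSymPlus_subDiagPoly n)
  rw [e.rank_eq, rank_subDiagPoly]

end Rank

end QuasisymmetricVariety

theorem mainTheorem9 (n : ℕ) :
    Nonempty ((MvPolynomial (Fin n) ℚ ⧸ QuasisymmetricVariety.idealQSymPlus n) ≃ₗ[ℚ]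
      (MvPolynomial (Fin n) ℚ ⧸ QuasisymmetricVariety.idealQSV n)) ∧
    Module.rank ℚ (MvPolynomial (Fin n) ℚ ⧸ QuasisymmetricVariety.idealQSymPlus n) =
      (catalan n : Cardinal) ∧
    Module.rank ℚ (MvPolynomial (Fin n) ℚ ⧸ QuasisymmetricVariety.idealQSV n) =
      (catalan n : Cardinal) := by
  have hQSym := QuasisymmetricVariety.rank_quotient_idealQSymPlus n
  have hQSV := QuasisymmetricVariety.rank_quotient_idealQSV n
  exact ⟨nonempty_linearEquiv_of_rank_eq (hQSym.trans hQSV.symm), hQSym, hQSV⟩
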